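/- **Theorem A.6.** A dynamic stream of an edge-weighted simple graph with vertex set $\{0,\dots,n-1\}$ is a finite sequence of elements, each of which inserts an absent edge with a weight, or deletes a present edge (and states its weight), starting from the empty edge set. A randomized streaming algorithm reads the stream once; its memory contents are bit strings, the distribution of the next memory contents depends only on the current ones and on the element read, and the distribution of the answer depends only on the final memory contents. Its space on a stream $S$ is the maximal length in bits of its memory contents during the reading of $S$, over all outcomes of its coins. A $k$-matching is a set of exactly $k$ edges no two of which share an endpoint; a correct answer to the maximum weighted $k$-matching problem is a $k$-matching of maximum weight in the final graph, or the report that there is none if the final graph has no $k$-matching. For every constant $\delta$ with $0\le\delta<1$ there are a real $c>0$ and a $W_0\in\mathbb N$, depending only on $\delta$, such that the following holds for every integer $W\ge W_0$, all integers $n,m,L$ with $W\le m\le\binom n2$ and $m+W\le L$, and every set $R\subseteq\mathbb R$ with at least $W$ elements. Let $\mathcal A$ be a randomized streaming algorithm for graphs on $n$ vertices which, on every dynamic stream with at most $L$ elements and with edge weights in $R$, answers the maximum weighted $1$-matching problem correctly with probability at least $1-\delta$. Then there is a dynamic stream with at most $L$ elements and with edge weights in $R$, in which exactly $W$ distinct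 edge weights occur and whose final graph has exactly $m$ edges, on which $\mathcal A$ uses at least $c\,W\log W$ bits of space. In particular, any randomized streaming algorithm in the dynamic model that computes a maximum weighted $1$-matching with probability at least $1-\delta$ uses $\Omega(W\log W)$ bits of space, where $W$ is the number of distinct edge weights in the stream, on graphs of arbitrarily large size. -/

import Mathlib

namespace WMatchStream

/-- The possible edges of a simple undirected graph with vertex set `{0, …, n-1}`. -/
abbrev Edge (n : ℕ) : Type := {e : Sym2 (Fin n) // ¬ e.IsDiag}

/-- A simple edge-weighted graph on `{0, …, n-1}`: `G e = some w` says that `e` is an edge of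
weight `w`, and `G e = none` says that `e` is not an edge. -/
abbrev WeightedGraph (n : ℕ) : Type := Edge n → Option ℝ

namespace WeightedGraph

variable {n : ℕ}

/-- The set of edges of `G`. -/
def edgeSet (G : WeightedGraph n) : Set (Edge n) := {e | G e ≠ none}

/-- `M` is a `k`-matching of `G`: it consists of exactly `k` edges of `G`, and no two of them
share an endpoint. -/
def IsKMatching (G : WeightedGraph n) (k : ℕ) (M : Finset (Edge n)) : Prop :=
  (∀ e ∈ M, e ∈ G.edgeSet) ∧ M.card = k ∧
    ∀ e ∈ M, ∀ f ∈ M, e ≠ f → ∀ v : Fin n, v ∈ e.1 → v ∉ f.1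

/-- The weight of a set of edges of `G` (the default value is never used for edges of `G`). -/
noncomputable def weight (G : WeightedGraph n) (M : Finset (Edge n)) : ℝ :=
  ∑ e ∈ M, (G e).getD 0

/-- `M` is a maximum weighted `k`-matching of `G`. -/
def IsMaxKMatching (G : WeightedGraph n) (k : ℕ) (M : Finset (Edge n)) : Prop :=
  G.IsKMatching k M ∧ ∀ M', G.IsKMatching k M' → G.weight M' ≤ G.weight M

/-- The correct answers to the maximum weighted `k`-matching problem on `G`: a maximum weighted
`k`-matching, or the report `none` if `G` has no `k`-matching. -/
def IsCorrectAnswer (G : WeightedGraph n) (k : ℕ) : Option (Finset (Edge n)) → Prop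
  | some M => G.IsMaxKMatching k M
  | none => ∀ M, ¬ G.IsKMatching k M

end WeightedGraph

/-- An element of a dynamic stream of a weighted graph: the insertion or the deletion of an edge,
together with the weight of this edge. -/
inductive Update (n : ℕ) : Type
  | insert (e : Edge n) (w : ℝ) : Update n
  | delete (e : Edge n) (w : ℝ) : Update n

namespace Update

variable {n : ℕ}

/-- The edge weight that a stream element carries. -/
def weight : Update n → ℝ
  | insert _ w => w
  | delete _ w => w

/-- The effect of a stream element on the current graph. -/
def apply (G : WeightedGraph n) : Update n → WeightedGraph n
  | insert e w => Function.update G e (some w)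
  | delete e _ => Function.update G e none

/-- Only absent edges are inserted, and only present edges are deleted (with their weight). -/
def Legal (G : WeightedGraph n) : Update n → Prop
  | insert e _ => G e = none
  | delete e w => G e = some w

end Update

section Streams

variable {n : ℕ}

/-- The graph given by a stream, which starts with the empty edge set. -/
def graphOf (S : List (Update n)) : WeightedGraph n :=
  S.foldl Update.apply (fun _ => none)

/-- Every element of the stream is legal when the stream is started on the graph `G`. -/
def LegalFrom : WeightedGraph n → List (Update n) → Prop
  | _, [] => True
  | G, u :: S => Update.Legal G u ∧ LegalFrom (Update.apply G u) S

/-- The set of edge weights that occur in a stream. -/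
def weightSet (S : List (Update n)) : Set ℝ := {w | ∃ u ∈ S, u.weight = w}

/-- `S` is a dynamic graph stream with at most `L` elements and with edge weights from `R`. -/
structure IsDynamicStream (R : Set ℝ) (L : ℕ) (S : List (Update n)) : Prop where
  legal : LegalFrom (fun _ => none) S
  weights : weightSet S ⊆ R
  length_le : S.length ≤ L

end Streams

/-- A (one-pass) randomized streaming algorithm for weighted graphs on `n` vertices. Its memory
contents are bit strings. It tosses fresh coins in every step, and all that it knows of the past,
earlier coins included, is in its memory. No computability is required, so that these are all
the streaming algorithms, uniform or not. -/
structure StreamingAlgorithm (n : ℕ) where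
  /-- the distribution of the initial memory contents -/
  init : PMF (List Bool)
  /-- the distribution of the new memory contents, given the old ones and the next element -/
  update : List Bool → Update n → PMF (List Bool)
  /-- the distribution of the answer, given the memory contents at the end of the stream -/
  output : List Bool → PMF (Option (Finset (Edge n)))

namespace StreamingAlgorithm

variable {n : ℕ}

/-- The distribution of the memory contents after the stream `S` has been read. -/
noncomputable def memory (A : StreamingAlgorithm n) (S : List (Update n)) : PMF (List Bool) :=
  S.foldl (fun p u => p.bind (fun s => A.update s u)) A.init

/-- The distribution of the answer on the stream `S`. -/
noncomputable def answer (A : StreamingAlgorithm n) (S : List (Update n)) :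
    PMF (Option (Finset (Edge n))) :=
  (A.memory S).bind A.output

/-- The space, in bits, that `A` uses on the stream `S`: the maximal length of the memory contents
at any time during the reading of `S`, over all outcomes of the coins. -/
noncomputable def space (A : StreamingAlgorithm n) (S : List (Update n)) : ℕ∞ :=
  ⨆ (P : List (Update n)) (_ : P <+: S) (s : List Bool) (_ : s ∈ (A.memory P).support),
    (s.length : ℕ∞)

/-- On every dynamic graph stream with at most `L` elements and with edge weights from `R`, the
answer of `A` to the maximum weighted `k`-matching problem is correct with probability at
least `p`. -/
def SolvesWMatching (A : StreamingAlgorithm n) (R : Set ℝ) (L k : ℕ) (p : ℝ) : Prop :=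
  ∀ S : List (Update n), IsDynamicStream R L S →
    ENNReal.ofReal p ≤ (A.answer S).toOuterMeasure {a | (graphOf S).IsCorrectAnswer k a}

end StreamingAlgorithm

end WMatchStream

/-! A short memory cannot store a permutation. Let `V = W - 1`. For a permutation `π` of `V` edges,
a hard stream inserts `m` edges, giving the edge of index `π i` the `i`-th largest weight and every
other edge the smallest one. Whoever knows the memory contents and `π 0, …, π (i-1)` can feed the
algorithm the deletions of the `i` heaviest edges; the only correct answer then reveals `π i`. So
some memory contents `x` predict the values of `π` in turn with average success at least `1 - δ`
(`hardStream_append_deletions`, `exists_mem_support_le_of_le_tsum`).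

Mixed with uniform guessing, the predictions from `x` give `π` weight at least `2^(-V) V^(-δV)`,
while by the chain rule these weights sum to at most `1` over all `π`. Hence at least `V! 2^(-V)
V^(-δV)` memory contents occur (`factorial_mul_le_card_messages`), and its logarithm is of order `(1
- δ) V log V`. Deletions serve only the decoding: space is bounded below on an insertion-only
stream. -/

namespace WMatchStream

/-! ### Counting messages by sequential prediction -/

/-- The chain rule for a sequence of conditional sub-probability weights. -/
theorem sum_prod_prefix_le_one {α : Type*} [Fintype α] (k : ℕ) (q : List α → α → ℝ)
    (hq : ∀ l a, 0 ≤ q l a) (hsum : ∀ l, ∑ a, q l a ≤ 1) :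
    ∑ f : Fin k → α, ∏ i : Fin k, q ((List.ofFn f).take i) (f i) ≤ 1 := by
  induction k generalizing q with
  | zero => simp
  | succ k ih =>
    rw [← (Fin.consEquiv fun _ : Fin (k + 1) => α).sum_comp, Fintype.sum_prod_type]
    calc _ = ∑ a, q [] a * ∑ f : Fin k → α,
          ∏ i : Fin k, q (a :: (List.ofFn f).take i) (f i) := by
            refine Finset.sum_congr rfl fun a _ => ?_
            rw [Finset.mul_sum]
            refine Finset.sum_congr rfl fun f _ => ?_
            simp [Fin.consEquiv, Fin.prod_univ_succ, List.ofFn_succ]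
      _ ≤ ∑ a, q [] a * 1 := by
            refine Finset.sum_le_sum fun a _ => mul_le_mul_of_nonneg_left ?_ (hq _ _)
            exact ih (fun l => q (a :: l)) (fun _ _ => hq _ _) (fun _ => hsum _)
      _ ≤ 1 := by simpa using hsum []

/-- Bernoulli's inequality for a prediction probability mixed with the uniform distribution. -/
theorem half_mul_rpow_le {V : ℕ} (hV : 0 < V) {a : ℝ} (h0 : 0 ≤ a) (h1 : a ≤ 1) :
    2⁻¹ * (V : ℝ) ^ (a - 1) ≤ 2⁻¹ * (a + (V : ℝ)⁻¹) := by
  have hV' : (1 : ℝ) ≤ V := by exact_mod_cast hV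
  have hpos : (0 : ℝ) < V := by linarith
  have h := rpow_one_add_le_one_add_mul_self (s := (V : ℝ) - 1) (by linarith) h0 h1
  rw [add_sub_cancel] at h
  rw [Real.rpow_sub_one hpos.ne', div_eq_mul_inv]
  have : (V : ℝ) ^ a * (V : ℝ)⁻¹ ≤ (1 + a * V) * (V : ℝ)⁻¹ := by
    gcongr
    nlinarith
  have h2 : (1 + a * V) * (V : ℝ)⁻¹ = a + (V : ℝ)⁻¹ := by field_simp; ring
  linarith

/-- If each permutation has a message from which its values can be predicted, one after the other
and from the previous ones, with average success probability at least `1 - δ`, then there are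
many messages. -/
theorem factorial_mul_le_card_messages {X : Type*} {V : ℕ} (hV : 0 < V) (s : Finset X)
    (a : X → List (Fin V) → Fin V → ℝ) (ha : ∀ x l b, 0 ≤ a x l b)
    (hsum : ∀ x l, ∑ b, a x l b ≤ 1) (δ : ℝ)
    (h : ∀ π : Equiv.Perm (Fin V), ∃ x ∈ s,
      V * (1 - δ) ≤ ∑ i : Fin V, a x ((List.ofFn π).take i) (π i)) :
    (V.factorial : ℝ) * (2⁻¹ ^ V * (V : ℝ) ^ (-(δ * V))) ≤ s.card := by
  classical
  have hV' : (1 : ℝ) ≤ V := by exact_mod_cast hV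
  have hpos : (0 : ℝ) < V := by linarith
  -- The uniform share keeps one failed prediction from annihilating the whole product; halving
  -- keeps the total mass at most `1`.
  set q : X → List (Fin V) → Fin V → ℝ := fun x l b => 2⁻¹ * (a x l b + (V : ℝ)⁻¹) with hqdef
  have hq : ∀ x l b, 0 ≤ q x l b := fun x l b => by
    have := ha x l b
    simp only [hqdef]; positivity
  have hqs : ∀ x l, ∑ b, q x l b ≤ 1 := fun x l => by
    simp only [hqdef]
    rw [← Finset.mul_sum, Finset.sum_add_distrib]
    have : ∑ _b : Fin V, (V : ℝ)⁻¹ = 1 := by simp [hpos.ne']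
    rw [this]
    linarith [hsum x l]
  set Q : X → (Fin V → Fin V) → ℝ := fun x f => ∏ i : Fin V, q x ((List.ofFn f).take i) (f i)
    with hQdef
  have hQ0 : ∀ x f, 0 ≤ Q x f := fun x f => Finset.prod_nonneg fun _ _ => hq _ _ _
  have key : ∀ π : Equiv.Perm (Fin V),
      2⁻¹ ^ V * (V : ℝ) ^ (-(δ * V)) ≤ ∑ x ∈ s, Q x π := fun π => by
    obtain ⟨x, hx, hxs⟩ := h π
    refine le_trans ?_ (Finset.single_le_sum (fun y _ => hQ0 y π) hx)
    have hle : ∀ i : Fin V, a x ((List.ofFn π).take i) (π i) ≤ 1 := fun i =>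
      (Finset.single_le_sum (fun b _ => ha x _ b) (Finset.mem_univ (π i))).trans (hsum x _)
    calc 2⁻¹ ^ V * (V : ℝ) ^ (-(δ * V))
        ≤ 2⁻¹ ^ V * (V : ℝ) ^ (∑ i : Fin V, (a x ((List.ofFn π).take i) (π i) - 1)) := by
          -- The base is at least `1`, and the exponents sum to at least `V * (1 - δ) - V = -(δ *
          -- V)`.
          gcongr
          simp only [Finset.sum_sub_distrib, Finset.sum_const, Finset.card_univ,
            Fintype.card_fin, nsmul_eq_mul]
          linarith
      _ = ∏ i : Fin V, 2⁻¹ * (V : ℝ) ^ (a x ((List.ofFn π).take i) (π i) - 1) := by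
          rw [Finset.prod_mul_distrib, Real.rpow_sum_of_pos hpos]
          simp
      _ ≤ Q x π := Finset.prod_le_prod (fun _ _ => by positivity)
          fun i _ => half_mul_rpow_le hV (ha _ _ _) (hle i)
  calc (V.factorial : ℝ) * (2⁻¹ ^ V * (V : ℝ) ^ (-(δ * V)))
      = ∑ _π : Equiv.Perm (Fin V), 2⁻¹ ^ V * (V : ℝ) ^ (-(δ * V)) := by
        simp [Fintype.card_perm]
    _ ≤ ∑ π : Equiv.Perm (Fin V), ∑ x ∈ s, Q x π := Finset.sum_le_sum fun π _ => key π
    _ = ∑ x ∈ s, ∑ π : Equiv.Perm (Fin V), Q x π := Finset.sum_comm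
    _ ≤ ∑ _x ∈ s, (1 : ℝ) := by
        refine Finset.sum_le_sum fun x _ => ?_
        calc ∑ π : Equiv.Perm (Fin V), Q x π
            = ∑ f ∈ Finset.univ.map ⟨fun π : Equiv.Perm (Fin V) => (π : Fin V → Fin V),
                DFunLike.coe_injective⟩, Q x f := by simp
          _ ≤ ∑ f, Q x f := Finset.sum_le_sum_of_subset_of_nonneg (Finset.subset_univ _)
              fun f _ _ => hQ0 x f
          _ ≤ 1 := sum_prod_prefix_le_one V (q x) (hq x) (hqs x)
    _ = s.card := by simp

/-- There are fewer than `2 ^ (s + 1)` bit strings of length at most `s`. -/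
theorem exists_finset_length_le (s : ℕ) :
    ∃ X : Finset (List Bool), (∀ x : List Bool, x.length ≤ s → x ∈ X) ∧ X.card ≤ 2 ^ (s + 1) := by
  classical
  refine ⟨(Finset.range (s + 1)).biUnion fun i =>
    Finset.univ.image fun v : Fin i → Bool => List.ofFn v, fun x hx => ?_, ?_⟩
  · simp only [Finset.mem_biUnion, Finset.mem_range, Finset.mem_image, Finset.mem_univ, true_and]
    exact ⟨x.length, by omega, x.get, List.ofFn_get x⟩
  · refine Finset.card_biUnion_le.trans ?_
    calc ∑ i ∈ Finset.range (s + 1), (Finset.univ.image fun v : Fin i → Bool => List.ofFn v).card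
        ≤ ∑ i ∈ Finset.range (s + 1), 2 ^ i := Finset.sum_le_sum fun i _ =>
          Finset.card_image_le.trans (by simp)
      _ ≤ 2 ^ (s + 1) := (Nat.geomSum_lt le_rfl (by simp)).le

/-- An average is attained or exceeded on the support. -/
theorem exists_mem_support_le_of_le_tsum {X : Type*} (p : PMF X) (f : X → ENNReal) {c : ENNReal}
    (hc : c ≠ ⊤) (h : c ≤ ∑' x, p x * f x) : ∃ x ∈ p.support, c ≤ f x := by
  by_contra! hlt
  obtain ⟨y, hy⟩ := p.support_nonempty
  have hsum : ∑' x, p x * c = c := by rw [ENNReal.tsum_mul_right, p.tsum_coe, one_mul]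
  have hle : ∀ x, p x * f x ≤ p x * c := fun x => by
    by_cases hx : x ∈ p.support
    · gcongr
      exact (hlt x hx).le
    · simp [(PMF.apply_eq_zero_iff p x).2 hx]
  have hne : ∑' x, p x * f x ≠ ⊤ :=
    ne_top_of_le_ne_top (by rwa [hsum]) (ENNReal.tsum_le_tsum hle)
  have : ∑' x, p x * f x < ∑' x, p x * c := by
    refine ENNReal.tsum_lt_tsum hne hle (i := y) ?_
    exact ENNReal.mul_lt_mul_right ((PMF.mem_support_iff p y).1 hy) (p.apply_ne_top y) (hlt y hy)
  rw [hsum] at this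
  exact absurd h (not_le.2 this)

/-! ### Streams of insertions and deletions -/

section Streams

variable {n : ℕ}

theorem legalFrom_append (G : WeightedGraph n) (S T : List (Update n)) :
    LegalFrom G (S ++ T) ↔ LegalFrom G S ∧ LegalFrom (S.foldl Update.apply G) T := by
  induction S generalizing G with
  | nil => simp [LegalFrom]
  | cons u S ih => simp [LegalFrom, ih, and_assoc]

open Classical in
/-- Inserting distinct absent edges. -/
theorem legalFrom_inserts (w : Edge n → ℝ) (l : List (Edge n)) (hl : l.Nodup)
    (G : WeightedGraph n) (hG : ∀ e ∈ l, G e = none) :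
    LegalFrom G (l.map fun e => Update.insert e (w e)) ∧
      (l.map fun e => Update.insert e (w e)).foldl Update.apply G =
        fun e => if e ∈ l then some (w e) else G e := by
  induction l generalizing G with
  | nil => simp [LegalFrom]
  | cons b l ih =>
    obtain ⟨hb, hl⟩ := List.nodup_cons.1 hl
    have hG' : ∀ e ∈ l, Update.apply G (Update.insert b (w b)) e = none := fun e he => by
      have : e ≠ b := fun h => hb (h ▸ he)
      simp [Update.apply, this, hG e (List.mem_cons_of_mem _ he)]
    obtain ⟨h1, h2⟩ := ih hl _ hG'
    refine ⟨⟨hG b List.mem_cons_self, h1⟩, ?_⟩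
    rw [List.map_cons, List.foldl_cons, h2]
    funext e
    by_cases heb : e = b
    · subst heb; simp [hb, Update.apply]
    · simp [heb, Update.apply]

open Classical in
/-- Deleting distinct present edges. -/
theorem legalFrom_deletes (w : Edge n → ℝ) (l : List (Edge n)) (hl : l.Nodup)
    (G : WeightedGraph n) (hG : ∀ e ∈ l, G e = some (w e)) :
    LegalFrom G (l.map fun e => Update.delete e (w e)) ∧
      (l.map fun e => Update.delete e (w e)).foldl Update.apply G =
        fun e => if e ∈ l then none else G e := by
  induction l generalizing G with
  | nil => simp [LegalFrom]
  | cons b l ih =>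
    obtain ⟨hb, hl⟩ := List.nodup_cons.1 hl
    have hG' : ∀ e ∈ l, Update.apply G (Update.delete b (w b)) e = some (w e) := fun e he => by
      have : e ≠ b := fun h => hb (h ▸ he)
      simp [Update.apply, this, hG e (List.mem_cons_of_mem _ he)]
    obtain ⟨h1, h2⟩ := ih hl _ hG'
    refine ⟨⟨hG b List.mem_cons_self, h1⟩, ?_⟩
    rw [List.map_cons, List.foldl_cons, h2]
    funext e
    by_cases heb : e = b
    · subst heb; simp [hb, Update.apply]
    · simp [heb, Update.apply]

/-- If `e` is the unique heaviest edge, then `{e}` is the only correct answer for `k = 1`. -/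
theorem WeightedGraph.IsCorrectAnswer.eq_some_singleton {G : WeightedGraph n} {e : Edge n} {w : ℝ}
    (he : G e = some w) (hmax : ∀ f v, G f = some v → f ≠ e → v < w)
    {a : Option (Finset (Edge n))} (ha : G.IsCorrectAnswer 1 a) : a = some {e} := by
  have hm : G.IsKMatching 1 {e} := by
    refine ⟨by simp [WeightedGraph.edgeSet, he], by simp, ?_⟩
    intro f hf g hg hfg
    simp only [Finset.mem_singleton] at hf hg
    exact absurd (hf.trans hg.symm) hfg
  cases a with
  | none => exact absurd hm (ha _)
  | some M =>
    obtain ⟨⟨hM1, hM2, -⟩, hM4⟩ := ha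
    obtain ⟨f, rfl⟩ := Finset.card_eq_one.1 hM2
    have hw := hM4 _ hm
    have hf := hM1 f (by simp)
    obtain ⟨v, hv⟩ := Option.ne_none_iff_exists'.1 hf
    simp only [WeightedGraph.weight, Finset.sum_singleton, he, hv, Option.getD_some] at hw
    by_contra hne
    have hfe : f ≠ e := fun h => hne (by rw [h])
    exact absurd (hmax f v hv hfe) (not_lt.2 hw)

end Streams

/-! ### Splitting a run at its memory contents -/

namespace StreamingAlgorithm

variable {n : ℕ}

/-- The distribution of the answer when the stream `T` is read from memory contents `x`. -/
noncomputable def answerFrom (A : StreamingAlgorithm n) (x : List Bool) (T : List (Update n)) :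
    PMF (Option (Finset (Edge n))) :=
  (T.foldl (fun p u => p.bind fun s => A.update s u) (PMF.pure x)).bind A.output

theorem foldl_bind_update (A : StreamingAlgorithm n) (p : PMF (List Bool)) (T : List (Update n)) :
    T.foldl (fun p u => p.bind fun s => A.update s u) p =
      p.bind fun x => T.foldl (fun p u => p.bind fun s => A.update s u) (PMF.pure x) := by
  induction T using List.reverseRecOn with
  | nil => simp
  | append_singleton T u ih => simp only [List.foldl_append, List.foldl_cons, List.foldl_nil, ih,
      PMF.bind_bind]

theorem answer_append (A : StreamingAlgorithm n) (S T : List (Update n)) :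
    A.answer (S ++ T) = (A.memory S).bind fun x => A.answerFrom x T := by
  unfold answer answerFrom memory
  rw [List.foldl_append, foldl_bind_update, PMF.bind_bind]

theorem length_le_space (A : StreamingAlgorithm n) (S : List (Update n)) {x : List Bool}
    (hx : x ∈ (A.memory S).support) : (x.length : ℕ∞) ≤ A.space S :=
  le_iSup₂_of_le S (List.prefix_refl S) (le_iSup₂_of_le x hx le_rfl)

end StreamingAlgorithm

/-! ### Hard streams and their decoding -/

section HardStreams

variable {n V : ℕ}

/-- The edge `e (π i)` gets the weight `r i`, and every edge outside the range of `e` gets the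
weight `r V`. -/
noncomputable def hardWeight (e : Fin V → Edge n) (r : ℕ → ℝ) (π : Equiv.Perm (Fin V)) :
    Edge n → ℝ :=
  Function.extend e (fun a => r (π.symm a)) fun _ => r V

/-- The insertion of the edges in the list `E`, weighted according to the permutation `π`. -/
noncomputable def hardStream (E : List (Edge n)) (e : Fin V → Edge n) (r : ℕ → ℝ)
    (π : Equiv.Perm (Fin V)) : List (Update n) :=
  E.map fun f => Update.insert f (hardWeight e r π f)

/-- The deletion of the edges with the given indices, listed by decreasing weight. -/
def deletions (e : Fin V → Edge n) (r : ℕ → ℝ) (l : List (Fin V)) : List (Update n) :=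
  l.zipIdx.map fun p => Update.delete (e p.1) (r p.2)

variable {e : Fin V → Edge n} {r : ℕ → ℝ} {E : List (Edge n)}

theorem hardWeight_apply (he : Function.Injective e) (π : Equiv.Perm (Fin V)) (i : Fin V) :
    hardWeight e r π (e (π i)) = r i := by
  simp [hardWeight, he.extend_apply]

theorem hardWeight_of_notMem (π : Equiv.Perm (Fin V)) {f : Edge n} (hf : ∀ i, e (π i) ≠ f) :
    hardWeight e r π f = r V :=
  Function.extend_apply' _ _ _ fun ⟨a, ha⟩ => hf (π.symm a) (by simpa using ha)

theorem exists_hardWeight_eq (he : Function.Injective e) (π : Equiv.Perm (Fin V)) (f : Edge n) :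
    ∃ j ≤ V, hardWeight e r π f = r j := by
  by_cases hf : ∃ i, e (π i) = f
  · obtain ⟨i, rfl⟩ := hf
    exact ⟨i, i.2.le, hardWeight_apply he π i⟩
  · push Not at hf
    exact ⟨V, le_rfl, hardWeight_of_notMem π hf⟩

/-- `deletions` refers only to the known prefix of indices, so the decoder can form it without `π`;
on a prefix of `π` the stated weights are the true ones. -/
theorem deletions_eq_map (he : Function.Injective e) (π : Equiv.Perm (Fin V)) (i : ℕ) :
    deletions e r ((List.ofFn π).take i) =
      (((List.ofFn π).take i).map e).map fun f => Update.delete f (hardWeight e r π f) := by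
  refine List.ext_getElem (by simp [deletions]) fun j h1 h2 => ?_
  have hj : j < V := by simp [deletions] at h1; omega
  simp [deletions, hardWeight_apply he π ⟨j, hj⟩]

theorem mem_take_ofFn (π : Equiv.Perm (Fin V)) (i : ℕ) (j : Fin V) :
    π j ∈ (List.ofFn π).take i ↔ (j : ℕ) < i := by
  rw [List.mem_take_iff_getElem]
  constructor
  · rintro ⟨k, hk, h⟩
    simp only [List.getElem_ofFn, EmbeddingLike.apply_eq_iff_eq] at h
    subst h
    exact (lt_min_iff.1 hk).1
  · exact fun h => ⟨j, by simp [h], by simp⟩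

theorem hardStream_spec (hE : E.Nodup) (π : Equiv.Perm (Fin V)) :
    LegalFrom (fun _ => none) (hardStream E e r π) ∧
      ∀ f, graphOf (hardStream E e r π) f =
        open Classical in if f ∈ E then some (hardWeight e r π f) else none := by
  classical
  obtain ⟨h1, h2⟩ := legalFrom_inserts (hardWeight e r π) E hE (fun _ => none) (by simp)
  refine ⟨h1, fun f => ?_⟩
  rw [graphOf, hardStream, h2]

/-- The edge supplied by `hout` makes the smallest weight `r V` occur, which brings the count to `V
+ 1`. -/
theorem weightSet_hardStream (he : Function.Injective e) (heE : ∀ a, e a ∈ E)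
    (hout : ∃ f ∈ E, ∀ a, e a ≠ f) (π : Equiv.Perm (Fin V)) :
    weightSet (hardStream E e r π) = r '' Set.Iic V := by
  ext w
  simp only [weightSet, hardStream, List.mem_map, Set.mem_ofPred_eq, Set.mem_image, Set.mem_Iic]
  constructor
  · rintro ⟨_, ⟨f, -, rfl⟩, rfl⟩
    obtain ⟨j, hj, h⟩ := exists_hardWeight_eq (r := r) he π f
    exact ⟨j, hj, h.symm⟩
  · rintro ⟨j, hj, rfl⟩
    rcases hj.lt_or_eq with hj | rfl
    · exact ⟨_, ⟨_, heE (π ⟨j, hj⟩), rfl⟩, hardWeight_apply he π ⟨j, hj⟩⟩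
    · obtain ⟨f, hfE, hf⟩ := hout
      exact ⟨_, ⟨f, hfE, rfl⟩, hardWeight_of_notMem π fun i => hf _⟩

theorem isDynamicStream_hardStream {R : Set ℝ} {L : ℕ} (he : Function.Injective e)
    (heE : ∀ a, e a ∈ E) (hout : ∃ f ∈ E, ∀ a, e a ≠ f) (hE : E.Nodup)
    (hr : ∀ j ≤ V, r j ∈ R) (hL : E.length ≤ L) (π : Equiv.Perm (Fin V)) :
    IsDynamicStream R L (hardStream E e r π) := by
  refine ⟨(hardStream_spec hE π).1, ?_, by simpa [hardStream] using hL⟩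
  rw [weightSet_hardStream he heE hout]
  rintro _ ⟨j, hj, rfl⟩
  exact hr j hj

theorem edgeSet_graphOf_hardStream (hE : E.Nodup) (π : Equiv.Perm (Fin V)) :
    (graphOf (hardStream E e r π)).edgeSet = {f | f ∈ E} := by
  ext f
  simp [WeightedGraph.edgeSet, (hardStream_spec hE π).2 f]

/-- The surviving edges have weights `r j` with `i ≤ j ≤ V`, and `r i` is carried by `e (π i)`
alone. -/
theorem hardStream_append_deletions {R : Set ℝ} {L : ℕ} (he : Function.Injective e)
    (heE : ∀ a, e a ∈ E) (hout : ∃ f ∈ E, ∀ a, e a ≠ f) (hE : E.Nodup)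
    (hr : ∀ j ≤ V, r j ∈ R) (hL : E.length + V ≤ L) (hanti : StrictAntiOn r (Set.Iic V))
    (π : Equiv.Perm (Fin V)) (i : Fin V) :
    IsDynamicStream R L (hardStream E e r π ++ deletions e r ((List.ofFn π).take i)) ∧
      ∀ a, (graphOf (hardStream E e r π ++ deletions e r ((List.ofFn π).take i))).IsCorrectAnswer
        1 a → a = some {e (π i)} := by
  classical
  obtain ⟨h1, h2⟩ := hardStream_spec (e := e) (r := r) hE π
  have hS := isDynamicStream_hardStream he heE hout hE hr (le_of_add_le_left hL) π
  have hnd : (((List.ofFn π).take i).map e).Nodup :=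
    ((List.nodup_ofFn.2 π.injective).sublist (List.take_sublist _ _)).map he
  obtain ⟨h3, h4⟩ := legalFrom_deletes (hardWeight e r π) _ hnd (graphOf (hardStream E e r π))
    fun f hf => by
      obtain ⟨a, -, rfl⟩ := List.mem_map.1 hf
      simp [h2, heE a]
  rw [← deletions_eq_map he] at h3 h4
  refine ⟨⟨(legalFrom_append _ _ _).2 ⟨h1, h3⟩, ?_, ?_⟩, fun a ha => ?_⟩
  · rintro w ⟨u, hu, rfl⟩
    rcases List.mem_append.1 hu with hu | hu
    · exact hS.weights ⟨u, hu, rfl⟩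
    · rw [deletions_eq_map he] at hu
      obtain ⟨f, -, rfl⟩ := List.mem_map.1 hu
      obtain ⟨j, hj, h⟩ := exists_hardWeight_eq (r := r) he π f
      change hardWeight e r π f ∈ R
      exact h ▸ hr j hj
  · have := i.2
    simp only [hardStream, deletions, List.length_append, List.length_map, List.length_zipIdx,
      List.length_take, List.length_ofFn]
    omega
  · have hg : ∀ f, graphOf (hardStream E e r π ++ deletions e r ((List.ofFn π).take i)) f =
        if f ∈ ((List.ofFn π).take i).map e then none
        else if f ∈ E then some (hardWeight e r π f) else none := fun f => by
      have h5 : graphOf (hardStream E e r π ++ deletions e r ((List.ofFn π).take i)) =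
        (deletions e r ((List.ofFn π).take i)).foldl Update.apply
          (graphOf (hardStream E e r π)) := by simp [graphOf]
      simp only [h5, h4, h2]
    refine ha.eq_some_singleton (w := r i) ?_ fun f v hf hfe => ?_
    · rw [hg, if_neg, if_pos (heE _), hardWeight_apply he]
      rw [List.mem_map_of_injective he, mem_take_ofFn]
      exact lt_irrefl _
    · rw [hg] at hf
      split_ifs at hf with hf1 hf2
      obtain rfl := Option.some.inj hf
      by_cases hfj : ∃ j, e (π j) = f
      · obtain ⟨j, rfl⟩ := hfj
        rw [List.mem_map_of_injective he, mem_take_ofFn, not_lt] at hf1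
        rw [hardWeight_apply he]
        have hji : j ≠ i := fun h => hfe (by rw [h])
        exact hanti i.2.le j.2.le (lt_of_le_of_ne hf1 fun h => hji (Fin.ext h.symm))
      · push Not at hfj
        rw [hardWeight_of_notMem π hfj]
        exact hanti i.2.le (Set.mem_Iic.2 le_rfl) i.2

/-- If the memory contents on all hard streams lie in `X`, then `X` is large. -/
theorem factorial_mul_le_card_memory {R : Set ℝ} {L : ℕ} (he : Function.Injective e)
    (heE : ∀ a, e a ∈ E) (hout : ∃ f ∈ E, ∀ a, e a ≠ f) (hE : E.Nodup)
    (hr : ∀ j ≤ V, r j ∈ R) (hL : E.length + V ≤ L) (hanti : StrictAntiOn r (Set.Iic V))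
    (hV : 0 < V) {δ : ℝ} (hδ : δ ≤ 1) (A : StreamingAlgorithm n)
    (hA : A.SolvesWMatching R L 1 (1 - δ)) (X : Finset (List Bool))
    (hX : ∀ π, ∀ x ∈ (A.memory (hardStream E e r π)).support, x ∈ X) :
    (V.factorial : ℝ) * (2⁻¹ ^ V * (V : ℝ) ^ (-(δ * V))) ≤ X.card := by
  classical
  have hinj : Function.Injective fun b : Fin V => (some {e b} : Option (Finset (Edge n))) :=
    fun b c h => he (Finset.singleton_injective (Option.some.inj h))
  set a : List Bool → List (Fin V) → Fin V → ENNReal := fun x l b =>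
    A.answerFrom x (deletions e r l) (some {e b}) with hadef
  have hatop : ∀ x l b, a x l b ≠ ⊤ := fun x l b => PMF.apply_ne_top _ _
  refine factorial_mul_le_card_messages hV X (fun x l b => (a x l b).toReal)
    (fun _ _ _ => ENNReal.toReal_nonneg) (fun x l => ?_) δ fun π => ?_
  · rw [← ENNReal.toReal_sum fun b _ => hatop x l b]
    refine ENNReal.toReal_le_of_le_ofReal zero_le_one ?_
    rw [ENNReal.ofReal_one, ← (A.answerFrom x (deletions e r l)).tsum_coe,
      ← tsum_fintype (L := SummationFilter.unconditional _)]
    exact ENNReal.tsum_comp_le_tsum_of_injective hinj _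
  · have hi : ∀ i : Fin V, ENNReal.ofReal (1 - δ) ≤
        ∑' x, A.memory (hardStream E e r π) x * a x ((List.ofFn π).take i) (π i) := fun i => by
      obtain ⟨hs, hc⟩ := hardStream_append_deletions he heE hout hE hr hL hanti π i
      refine (hA _ hs).trans ?_
      calc _ ≤ (A.answer (hardStream E e r π ++
              deletions e r ((List.ofFn π).take i))).toOuterMeasure {some {e (π i)}} :=
            MeasureTheory.measure_mono fun b hb => hc b hb
        _ = _ := by
          rw [PMF.toOuterMeasure_apply_singleton, A.answer_append, PMF.bind_apply]
    -- Summing over `i` before choosing `x` yields one message that serves all positions.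
    obtain ⟨x, hx, hle⟩ := exists_mem_support_le_of_le_tsum (A.memory (hardStream E e r π))
      (fun x => ∑ i : Fin V, a x ((List.ofFn π).take i) (π i))
      (c := ∑ _i : Fin V, ENNReal.ofReal (1 - δ)) (by simp [ENNReal.mul_eq_top]) (by
        simp_rw [Finset.mul_sum]
        rw [Summable.tsum_finsetSum fun _ _ => ENNReal.summable]
        exact Finset.sum_le_sum fun i _ => hi i)
    refine ⟨x, hX π x hx, ?_⟩
    have := ENNReal.toReal_mono (ENNReal.sum_ne_top.2 fun i _ => hatop _ _ _) hle
    rw [ENNReal.toReal_sum fun i _ => hatop _ _ _] at this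
    simpa [ENNReal.toReal_ofReal (sub_nonneg.2 hδ)] using this

end HardStreams

/-! ### Choice of weights and edges, asymptotics, conclusion -/

/-- A set of at least `V + 1` reals contains a strictly decreasing sequence of length `V + 1`. -/
theorem exists_strictAntiOn_Iic {R : Set ℝ} {V : ℕ} (hR : ((V + 1 : ℕ) : ℕ∞) ≤ R.encard) :
    ∃ r : ℕ → ℝ, StrictAntiOn r (Set.Iic V) ∧ ∀ j ≤ V, r j ∈ R := by
  obtain ⟨T, hTR, hT⟩ := Set.exists_subset_encard_eq hR
  have hfin : T.Finite := Set.finite_of_encard_eq_coe hT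
  have hcard : hfin.toFinset.card = V + 1 := by
    rw [hfin.encard_eq_coe_toFinset_card] at hT
    exact_mod_cast hT
  refine ⟨fun j => hfin.toFinset.orderEmbOfFin hcard ⟨V - j, by omega⟩, ?_, fun j _ => ?_⟩
  · intro i hi j hj hij
    simp only [Set.mem_Iic] at hi hj
    simp only [OrderEmbedding.lt_iff_lt, Fin.mk_lt_mk]
    omega
  · exact hTR (hfin.mem_toFinset.1 (Finset.orderEmbOfFin_mem _ hcard _))

theorem exists_edge_list {n V m : ℕ} (hVm : V < m) (hm : m ≤ n.choose 2) :
    ∃ (E : List (Edge n)) (e : Fin V → Edge n), E.Nodup ∧ E.length = m ∧ Function.Injective e ∧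
      (∀ a, e a ∈ E) ∧ ∃ f ∈ E, ∀ a, e a ≠ f := by
  classical
  have hcard : Fintype.card (Fin m) ≤ Fintype.card (Edge n) := by
    rw [Sym2.card_subtype_not_diag]
    simpa using hm
  obtain ⟨g⟩ := Function.Embedding.nonempty_of_card_le hcard
  -- The first `V` edges carry the permutation; edge number `V` exists since `V < m` and lies
  -- outside the range of `e`.
  refine ⟨List.ofFn g, fun a => g (Fin.castLE hVm.le a), List.nodup_ofFn.2 g.injective, by simp,
    g.injective.comp (Fin.castLE_injective _), fun a => by simp, g ⟨V, hVm⟩, by simp, ?_⟩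
  intro a h
  have := congrArg Fin.val (g.injective h)
  simp only [Fin.val_castLE] at this
  exact a.2.ne this

/-- The logarithmic form of the counting bound, for `V` large in terms of `δ`. -/
theorem mul_log_lt_of_factorial_le {δ : ℝ} (hδ : δ < 1) {V s : ℕ} (hV : 2 ≤ V)
    (hlog : 4 ≤ (1 - δ) * Real.log V)
    (h : (V.factorial : ℝ) * (2⁻¹ ^ V * (V : ℝ) ^ (-(δ * V))) ≤ 2 ^ (s + 1)) :
    (1 - δ) / 16 * (((V + 1 : ℕ) : ℝ) * Real.log ((V + 1 : ℕ) : ℝ)) < s := by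
  have hV2 : (2 : ℝ) ≤ V := by exact_mod_cast hV
  have hpos : (0 : ℝ) < V := by linarith
  -- From `V ^ V / V! ≤ exp V`.
  have hfact : (V : ℝ) * Real.log V - V ≤ Real.log V.factorial := by
    have h1 := Real.pow_div_factorial_le_exp (V : ℝ) hpos.le V
    have h2 := Real.log_le_log (by positivity) h1
    rw [Real.log_exp, Real.log_div (by positivity) (by positivity), Real.log_pow] at h2
    linarith
  have hl := Real.log_le_log (by positivity) h
  rw [Real.log_mul (by positivity) (by positivity), Real.log_mul (by positivity) (by positivity),
    Real.log_pow, Real.log_pow, Real.log_inv, Real.log_rpow hpos] at hl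
  push_cast at hl ⊢
  have hlog2 : Real.log 2 < 1 := by linarith [Real.log_two_lt_d9]
  have hlogV : Real.log ((V : ℝ) + 1) ≤ 2 * Real.log V := by
    rw [← Real.log_rpow hpos]
    refine Real.log_le_log (by positivity) ?_
    norm_num
    nlinarith
  have hlp : 0 < Real.log V := Real.log_pos (by linarith)
  have hW : ((V : ℝ) + 1) * Real.log ((V : ℝ) + 1) ≤ 4 * (V * Real.log V) := by
    calc _ ≤ (2 * V) * (2 * Real.log V) := by
          have : 0 ≤ Real.log ((V : ℝ) + 1) := Real.log_nonneg (by linarith)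
          gcongr
          linarith
      _ = _ := by ring
  have h1 : (1 - δ) / 16 * (((V : ℝ) + 1) * Real.log ((V : ℝ) + 1)) ≤
      (1 - δ) / 16 * (4 * (V * Real.log V)) :=
    mul_le_mul_of_nonneg_left hW (by linarith)
  have h2 : 4 * (V : ℝ) ≤ (1 - δ) * Real.log V * V := mul_le_mul_of_nonneg_right hlog hpos.le
  have h3 : (V : ℝ) * Real.log 2 ≤ V := by nlinarith
  have h4 : ((s : ℝ) + 1) * Real.log 2 ≤ s + 1 := by
    have : (0 : ℝ) ≤ s := s.cast_nonneg
    nlinarith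
  -- The count gives `s + 1 ≥ (1 - δ) V log V - 2V ≥ (1 - δ) V log V / 2`, by `h2`. As `(1 - δ) V
  -- log V / 4 ≥ V > 1`, this quarter absorbs the `1`, and `h1` bounds the claimed quantity by the
  -- other quarter.
  nlinarith

end WMatchStream

theorem theoremA6 (δ : ℝ) (hδ₀ : 0 ≤ δ) (hδ₁ : δ < 1) :
    ∃ c : ℝ, 0 < c ∧ ∃ W₀ : ℕ, ∀ W : ℕ, W₀ ≤ W →
      ∀ (n m L : ℕ) (R : Set ℝ), W ≤ m → m ≤ n.choose 2 → m + W ≤ L → (W : ℕ∞) ≤ R.encard →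
        ∀ A : WMatchStream.StreamingAlgorithm n, A.SolvesWMatching R L 1 (1 - δ) →
          ∃ S : List (WMatchStream.Update n), WMatchStream.IsDynamicStream R L S ∧
            (WMatchStream.weightSet S).ncard = W ∧
            (WMatchStream.graphOf S).edgeSet.ncard = m ∧
            ENNReal.ofReal (c * ((W : ℝ) * Real.log (W : ℝ))) ≤ ((A.space S : ℕ∞) : ENNReal) := by
  -- The threshold ensures `V ≥ 2` and `(1 - δ) * log V ≥ 4` for `V = W - 1`.
  refine ⟨(1 - δ) / 16, by linarith, ⌈Real.exp (4 / (1 - δ))⌉₊ + 3, ?_⟩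
  intro W hW n m L R hWm hm hL hR A hA
  obtain ⟨V, rfl⟩ : ∃ V, W = V + 1 := ⟨W - 1, by omega⟩
  obtain ⟨r, hanti, hr⟩ := WMatchStream.exists_strictAntiOn_Iic hR
  obtain ⟨E, e, hE, hEm, he, heE, hout⟩ := WMatchStream.exists_edge_list hWm hm
  -- The negation bounds the space on all hard streams at once, as the counting requires.
  by_contra! hcon
  set T : ℝ := (1 - δ) / 16 * (((V + 1 : ℕ) : ℝ) * Real.log ((V + 1 : ℕ) : ℝ)) with hT
  have hspace : ∀ π : Equiv.Perm (Fin V),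
      ∀ x ∈ (A.memory (WMatchStream.hardStream E e r π)).support, x.length ≤ ⌊T⌋₊ := by
    intro π x hx
    have hlt := hcon (WMatchStream.hardStream E e r π)
      (WMatchStream.isDynamicStream_hardStream he heE hout hE hr (by omega) π)
      (by
        rw [WMatchStream.weightSet_hardStream he heE hout, hanti.injOn.ncard_image,
          Set.ncard_eq_toFinset_card', Set.toFinset_Iic, Nat.card_Iic])
      (by
        rw [WMatchStream.edgeSet_graphOf_hardStream hE, ← List.coe_toFinset,
          Set.ncard_coe_finset, List.toFinset_card_of_nodup hE, hEm])
    have hle := (ENat.toENNReal_le.2 (A.length_le_space _ hx)).trans_lt hlt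
    rw [ENat.toENNReal_coe, ← ENNReal.ofReal_natCast] at hle
    exact Nat.le_floor ((ENNReal.ofReal_lt_ofReal_iff'.1 hle).1).le
  obtain ⟨X, hX, hXcard⟩ := WMatchStream.exists_finset_length_le ⌊T⌋₊
  have hcount := WMatchStream.factorial_mul_le_card_memory he heE hout hE hr (by omega) hanti
    (by omega) hδ₁.le A hA X fun π x hx => hX x (hspace π x hx)
  have hVe : Real.exp (4 / (1 - δ)) ≤ V :=
    (Nat.le_ceil _).trans (by exact_mod_cast (by omega : ⌈Real.exp (4 / (1 - δ))⌉₊ ≤ V))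
  have hlog : 4 ≤ (1 - δ) * Real.log V := by
    have h := Real.log_le_log (Real.exp_pos _) hVe
    rw [Real.log_exp, div_le_iff₀ (by linarith)] at h
    linarith
  have hlt := WMatchStream.mul_log_lt_of_factorial_le hδ₁ (by omega) hlog
    (hcount.trans (by exact_mod_cast hXcard))
  -- The count forces `T < ⌊T⌋₊`, impossible for `T ≥ 0`.
  refine absurd (Nat.floor_le ?_) (not_le.2 hlt)
  exact mul_nonneg (by linarith) (mul_nonneg (Nat.cast_nonneg _) (Real.log_natCast_nonneg _))
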